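/- For $x,z\in\mathbb R^L$ write $px=\sum_l p_lx_l$, and $x\ge z$ if $x_l\ge z_l$ for all $l$ and $x\ne z$. Let $X\subseteq\mathbb R^L_+\setminus\{0\}$ be a convex set of bundles, $P\subseteq\mathbb R^L_{++}$ a set of prices, and $\mathbf x$ a demand correspondence that assigns to every price $p\in P$ and wealth $w$ a (possibly empty) set $\mathbf x(p,w)\subseteq X$. Let $$\mathbf O=\{(p,x): p\in P,\ x\in\mathbf x(p,px)\}$$ be the data set (finite or infinite), and assume that $\mathbf O$ is nonempty and compact. A preference function is a map $r:X\times X\to\mathbb R$. It is \emph{skew-symmetric} if $r(x,y)=-r(y,x)$ for all $x,y\in X$; \emph{locally nonsatiated} if for all $x,y\in X$ with $r(x,y)=0$ and all $\epsilon>0$ there is $y'\in X$ within distance $\epsilon$ of $y$ with $r(x,y')<0$; \emph{continuous} (respectively \emph{concave}) if $r(\cdot,y)$ is so on $X$ for every $y\in X$; \emph{strictly increasing} if $r(x,y)>r(z,y)$ for all $x,y,z\in X$ with $x\ge z$. It \emph{rationalizes the data as a quasilinear preference function} if $r(x,y)-p(x-y)\ge 0$ for all $(p,x)\in\mathbf O$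 and $y\in X$. A \emph{generalized maximin quasilinear preference function} is an $r$ such that for all $x,y\in X$ $$r(x,y)=\max_{\mu\in\Delta(\mathbf O)}\min_{\lambda\in\Delta(\mathbf O)}\int_{o_1\in\mathbf O}\int_{o_2\in\mathbf O}\bigl(u_{o_1o_2}(x)-u_{o_1o_2}(y)\bigr)\,d\lambda(o_1)\,d\mu(o_2),$$ where $\Delta(\mathbf O)$ is the set of Borel probability measures on $\mathbf O$, and $u_{o_1o_2}:X\to\mathbb R$ $(o_1,o_2\in\mathbf O)$ are functions such that $u_{o_1o_2}=u_{o_2o_1}$; $(o_1,o_2)\mapsto u_{o_1o_2}(x)$ is continuous on $\mathbf O^2$ for every $x\in X$; and every $u_{o_1o_2}$ is continuous, strictly increasing (with respect to $\ge$), concave, and quasilinear, meaning that $u_{o_1o_2}(a)-pa\ge u_{o_1o_2}(y)-py$ for all $y\in X$ and both observations $(p,a)\in\{o_1,o_2\}$. Consider the following statements. 1. The data can be rationalized by a locally nonsatiated, skew-symmetric, quasilinear preference function. 2. The data satisfy the law of demand: $(p-q)(x-y)\le 0$ for all $(p,x),(q,y)\in\mathbf O$. 3. The data can be rationalized by a generalized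 maximin quasilinear preference function. 4. The data can be rationalized by a continuous, strictly increasing, concave, skew-symmetric, quasilinear preference function. If every neighbourhood of every $x\in X$ contains some $y\in X$ with $y\ge x$ (for instance if $X=\mathbb R^L_+\setminus\{0\}$ with $L\geq 1$), then statements 1, 2, 3 and 4 are equivalent. Without this assumption on $X$ (for instance for compact $X$), statements 2, 3 and 4 are still equivalent, and statement 1 implies them. -/

import Mathlib

open MeasureTheory Set

/-- Vectors of `ℝ^L`: prices and bundles. On `Fin L → ℝ` the order `x ≤ y` is the coordinatewise
one, and `x < y` means `x ≤ y` and `x ≠ y`. -/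
abbrev Vec (L : ℕ) : Type := Fin L → ℝ

/-- An observation `(p, x)`: a price vector and a bundle chosen at these prices. -/
abbrev Obs (L : ℕ) : Type := Vec L × Vec L

/-- The strictly positive price vectors. -/
def positivePrices (L : ℕ) : Set (Vec L) := {p | ∀ i, 0 < p i}

/-- The nonnegative, nonzero bundles. -/
def nonzeroBundles (L : ℕ) : Set (Vec L) := {x | (∀ i, 0 ≤ x i) ∧ x ≠ 0}

/-- The data set generated by a demand correspondence `D` (prices and wealth to sets of bundles) on
the price set `P`: all pairs `(p, x)` with `p ∈ P` and `x ∈ D (p, p x)`. -/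
def demandData {L : ℕ} (P : Set (Vec L)) (D : Vec L → ℝ → Set (Vec L)) : Set (Obs L) :=
  {o | o.1 ∈ P ∧ o.2 ∈ D o.1 (o.1 ⬝ᵥ o.2)}

/-- The law of demand. -/
def LawOfDemand {L : ℕ} (O : Set (Obs L)) : Prop :=
  ∀ p x q y, (p, x) ∈ O → (q, y) ∈ O → (p - q) ⬝ᵥ (x - y) ≤ 0

/-- Every bundle of `X` has arbitrarily close larger bundles in `X`. -/
def HasNearbyLargerBundles {L : ℕ} (X : Set (Vec L)) : Prop :=
  ∀ x ∈ X, ∀ ε > 0, ∃ y ∈ X, x < y ∧ dist y x < ε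

/-! ### Properties of preference functions `r : X × X → ℝ` -/

/-- Skew-symmetry on `X`. -/
def SkewSymmetricOn {L : ℕ} (X : Set (Vec L)) (r : Vec L → Vec L → ℝ) : Prop :=
  ∀ x ∈ X, ∀ y ∈ X, r x y = - r y x

/-- Local nonsatiation on `X`. -/
def LocallyNonsatiatedOn {L : ℕ} (X : Set (Vec L)) (r : Vec L → Vec L → ℝ) : Prop :=
  ∀ x ∈ X, ∀ y ∈ X, r x y = 0 → ∀ ε > 0, ∃ y' ∈ X, dist y' y < ε ∧ r x y' < 0

/-- Continuity on `X` (in the first argument). -/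
def ContinuousPrefOn {L : ℕ} (X : Set (Vec L)) (r : Vec L → Vec L → ℝ) : Prop :=
  ∀ y ∈ X, ContinuousOn (fun x => r x y) X

/-- Strict monotonicity on `X` (in the first argument). -/
def StrictlyIncreasingPrefOn {L : ℕ} (X : Set (Vec L)) (r : Vec L → Vec L → ℝ) : Prop :=
  ∀ y ∈ X, StrictMonoOn (fun x => r x y) X

/-- Concavity on `X` (in the first argument). -/
def ConcavePrefOn {L : ℕ} (X : Set (Vec L)) (r : Vec L → Vec L → ℝ) : Prop :=
  ∀ y ∈ X, ConcaveOn ℝ X (fun x => r x y)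

/-- The data set `O` is rationalized by `r` as a quasilinear preference function:
`r(x, y) - p (x - y) ≥ 0` for every observation `(p, x)` and every bundle `y`. -/
def QuasilinearPrefRationalizes {L : ℕ} (X : Set (Vec L)) (O : Set (Obs L))
    (r : Vec L → Vec L → ℝ) : Prop :=
  ∀ p x, (p, x) ∈ O → ∀ y ∈ X, 0 ≤ r x y - p ⬝ᵥ (x - y)

/-! ### The generalized maximin quasilinear model -/

/-- The utility function `v` rationalizes the observation `o = (p, a)` quasilinearly:
`v(a) - p a ≥ v(y) - p y` for every bundle `y`. -/
def QuasilinearUtilityRationalizes {L : ℕ} (X : Set (Vec L)) (o : Obs L) (v : Vec L → ℝ) : Prop :=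
  ∀ y ∈ X, v y - o.1 ⬝ᵥ y ≤ v o.2 - o.1 ⬝ᵥ o.2

/-- A family of quasilinear local utility functions `u_{o₁ o₂}`, one for each reference point, i.e.
for each pair of observations. Quasilinearity says that `u_{o₁ o₂}` rationalizes `o₁` and `o₂`
quasilinearly. -/
structure IsQuasilinearLocalUtility {L : ℕ} (X : Set (Vec L)) (O : Set (Obs L))
    (u : O → O → Vec L → ℝ) : Prop where
  /-- Independence of permutations. -/
  symm : ∀ o₁ o₂, u o₁ o₂ = u o₂ o₁
  /-- Continuity in the reference point, at every bundle. -/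
  continuous_ref : ∀ x ∈ X, Continuous fun o : O × O => u o.1 o.2 x
  continuousOn : ∀ o₁ o₂, ContinuousOn (u o₁ o₂) X
  strictMonoOn : ∀ o₁ o₂, StrictMonoOn (u o₁ o₂) X
  concaveOn : ∀ o₁ o₂, ConcaveOn ℝ X (u o₁ o₂)
  quasilinear_left : ∀ o₁ o₂ : O, QuasilinearUtilityRationalizes X (o₁ : Obs L) (u o₁ o₂)
  quasilinear_right : ∀ o₁ o₂ : O, QuasilinearUtilityRationalizes X (o₂ : Obs L) (u o₁ o₂)

/-- A quasilinear local utility also rationalizes its own observations in the ordinary sense, weakly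
and strictly. -/
theorem QuasilinearUtilityRationalizes.revealed {L : ℕ} {X : Set (Vec L)} {o : Obs L}
    {v : Vec L → ℝ} (h : QuasilinearUtilityRationalizes X o v) {y : Vec L} (hy : y ∈ X) :
    (o.1 ⬝ᵥ y ≤ o.1 ⬝ᵥ o.2 → v y ≤ v o.2) ∧ (o.1 ⬝ᵥ y < o.1 ⬝ᵥ o.2 → v y < v o.2) := by
  have := h y hy
  constructor <;> intro _ <;> linarith

/-- The payoff `∫ ∫ (u_{o₁ o₂}(x) - u_{o₁ o₂}(y)) dν(o₁) dμ(o₂)`. -/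
noncomputable def maximinPayoff {L : ℕ} {O : Set (Obs L)} (u : O → O → Vec L → ℝ) (x y : Vec L)
    (ν μ : ProbabilityMeasure O) : ℝ :=
  ∫ o₁, ∫ o₂, (u o₁ o₂ x - u o₁ o₂ y) ∂(μ : Measure O) ∂(ν : Measure O)

/-- `r` is a generalized maximin quasilinear preference function: for all `x, y ∈ X`, `r(x, y)` is
the (attained) maximum over `μ` of the (attained) minimum over `ν` of the payoff, for some family of
quasilinear local utility functions. -/
def IsGeneralizedMaximinQuasilinear {L : ℕ} (X : Set (Vec L)) (O : Set (Obs L))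
    (r : Vec L → Vec L → ℝ) : Prop :=
  ∃ u : O → O → Vec L → ℝ, IsQuasilinearLocalUtility X O u ∧
    ∀ x ∈ X, ∀ y ∈ X,
      IsGreatest
        {m : ℝ | ∃ μ : ProbabilityMeasure O,
          IsLeast (range fun ν : ProbabilityMeasure O => maximinPayoff u x y ν μ) m}
        (r x y)

/-! ### The three kinds of rationalizability -/

/-- The data can be rationalized by a locally nonsatiated, skew-symmetric, quasilinear preference
function. -/
def RationalizableLNS {L : ℕ} (X : Set (Vec L)) (O : Set (Obs L)) : Prop :=
  ∃ r : Vec L → Vec L → ℝ, LocallyNonsatiatedOn X r ∧ SkewSymmetricOn X r ∧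
    QuasilinearPrefRationalizes X O r

/-- The data can be rationalized by a generalized maximin quasilinear preference function. -/
def RationalizableMaximin {L : ℕ} (X : Set (Vec L)) (O : Set (Obs L)) : Prop :=
  ∃ r : Vec L → Vec L → ℝ, IsGeneralizedMaximinQuasilinear X O r ∧
    QuasilinearPrefRationalizes X O r

/-- The data can be rationalized by a continuous, strictly increasing, concave, skew-symmetric,
quasilinear preference function. -/
def RationalizableConcave {L : ℕ} (X : Set (Vec L)) (O : Set (Obs L)) : Prop :=
  ∃ r : Vec L → Vec L → ℝ, ContinuousPrefOn X r ∧ StrictlyIncreasingPrefOn X r ∧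
    ConcavePrefOn X r ∧ SkewSymmetricOn X r ∧ QuasilinearPrefRationalizes X O r

/-! Everything passes through the law of demand. It is necessary: adding the quasilinear
inequalities of two observations, each tested at the other's bundle, yields it, either from
skew-symmetry of `r` or because both inequalities concern the same function `u o₁ o₂`.

For the maximin model, take as `localUtility` the minimum of two affine functions whose gradients
are the two prices, normalized so that the law of demand says exactly that each one is the smaller
at its own bundle. The maximin is attained by compactness (`exists_isGreatest_isLeast_integral`). If
`(p, x)` is observed, the Dirac mass there guarantees the maximizer at least `p (x - y)`.

For the concave model, let φ be `cheapestValue` and let `s x y` be the maximum of `e - q y + φ (x -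
b)` over the closed convex hull of the triples (price `q`, bundle `b`, expenditure `e`). Then `s` is
concave in `x` and convex in `y`. If `(p, x)` is observed, then `s x y ≥ p (x - y)`, and by the law
of demand `s y x ≤ p (y - x)`. So `(s x y - s y x) / 2` is skew-symmetric, concave in `x` and
rationalizes the data. -/

section MaximinIntegral

/-! ### Attainment of the maximin over probability measures -/

variable {K : Type*} [MetricSpace K] [CompactSpace K] [MeasurableSpace K] [BorelSpace K]

theorem continuous_integral_right_of_compactSpace {f : K → K → ℝ}
    (hf : Continuous fun z : K × K => f z.1 z.2) (μ : ProbabilityMeasure K) :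
    Continuous fun o₁ => ∫ o₂, f o₁ o₂ ∂(μ : Measure K) := by
  simpa using continuous_parametric_integral_of_continuous (μ := (μ : Measure K))
    (f := f) hf isCompact_univ

/-- A continuous function on a compact space attains its least mean at a Dirac mass. -/
theorem exists_isLeast_integral [Nonempty K] {h : K → ℝ} (hh : Continuous h) :
    ∃ o, (∀ o₁, h o ≤ h o₁) ∧
      IsLeast (range fun ν : ProbabilityMeasure K => ∫ o₁, h o₁ ∂(ν : Measure K)) (h o) := by
  obtain ⟨o, -, ho⟩ := isCompact_univ.exists_isMinOn univ_nonempty hh.continuousOn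
  have ho' : ∀ o₁, h o ≤ h o₁ := fun o₁ => ho (mem_univ o₁)
  refine ⟨o, ho', ⟨diracProba o, by simp [diracProba]⟩, ?_⟩
  rintro _ ⟨ν, rfl⟩
  have hint : Integrable h (ν : Measure K) :=
    hh.integrable_of_hasCompactSupport (HasCompactSupport.of_compactSpace _)
  simpa using integral_mono (integrable_const (h o)) hint ho'

open Filter Topology in
/-- On a compact metric space, the maximin over mixed strategies of a continuous payoff is
attained. -/
theorem exists_isGreatest_isLeast_integral [Nonempty K] {f : K → K → ℝ}
    (hf : Continuous fun z : K × K => f z.1 z.2) :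
    ∃ m, IsGreatest {m : ℝ | ∃ μ : ProbabilityMeasure K,
      IsLeast (range fun ν : ProbabilityMeasure K =>
        ∫ o₁, ∫ o₂, f o₁ o₂ ∂(μ : Measure K) ∂(ν : Measure K)) m} m := by
  set h : ProbabilityMeasure K → K → ℝ := fun μ o₁ => ∫ o₂, f o₁ o₂ ∂(μ : Measure K)
  have h_cont : ∀ o₁, Continuous fun μ => h μ o₁ := fun o₁ => by
    let g : BoundedContinuousFunction K ℝ :=
      BoundedContinuousFunction.mkOfCompact ⟨f o₁, hf.comp (by fun_prop : Continuous (Prod.mk o₁))⟩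
    rw [continuous_iff_continuousAt]
    intro μ
    exact (ProbabilityMeasure.tendsto_iff_forall_integral_tendsto.1 tendsto_id) g
  choose σ hσ h_least using fun μ =>
    exists_isLeast_integral (continuous_integral_right_of_compactSpace hf μ)
  -- The least payoff is a pointwise minimum of weakly continuous functions of `μ`: the minimizer `σ
  -- μ` of one measure bounds the minimum at nearby measures from above.
  have h_usc : UpperSemicontinuousOn (fun μ => h μ (σ μ)) univ := by
    rw [upperSemicontinuousOn_univ_iff]
    intro μ y hy
    filter_upwards [(h_cont (σ μ)).continuousAt.eventually_lt_const hy] with μ' hμ'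
    exact (hσ μ' (σ μ)).trans_lt hμ'
  have : Nonempty (ProbabilityMeasure K) := ⟨diracProba (Classical.arbitrary K)⟩
  obtain ⟨μ, -, hμ⟩ := h_usc.exists_isMaxOn univ_nonempty isCompact_univ
  refine ⟨h μ (σ μ), ⟨μ, h_least μ⟩, ?_⟩
  rintro m ⟨μ', hμ'⟩
  exact (hμ'.unique (h_least μ')).trans_le (hμ (mem_univ μ'))

end MaximinIntegral

/-! ### Necessity of the law of demand, and local nonsatiation -/

section Observations

variable {L : ℕ} {X : Set (Vec L)} {O : Set (Obs L)}

theorem dotProduct_lt_dotProduct_of_positivePrices {p x y : Vec L} (hp : p ∈ positivePrices L)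
    (hxy : x < y) : p ⬝ᵥ x < p ⬝ᵥ y := by
  obtain ⟨hle, i, hi⟩ := Pi.lt_def.1 hxy
  exact Finset.sum_lt_sum (fun j _ => mul_le_mul_of_nonneg_left (hle j) (hp j).le)
    ⟨i, Finset.mem_univ i, mul_lt_mul_of_pos_left hi (hp i)⟩

/-- A skew-symmetric rationalization forces the law of demand. -/
theorem lawOfDemand_of_skewSymmetricOn {r : Vec L → Vec L → ℝ} (hO : ∀ o ∈ O, o.2 ∈ X)
    (hskew : SkewSymmetricOn X r) (hr : QuasilinearPrefRationalizes X O r) : LawOfDemand O := by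
  intro p x q y hx hy
  have h₁ := hr p x hx y (hO _ hy)
  have h₂ := hr q y hy x (hO _ hx)
  have h₃ := hskew x (hO _ hx) y (hO _ hy)
  simp only [sub_dotProduct, dotProduct_sub] at *
  linarith

/-- A family of quasilinear local utility functions forces the law of demand. -/
theorem IsQuasilinearLocalUtility.lawOfDemand {u : O → O → Vec L → ℝ} (hO : ∀ o ∈ O, o.2 ∈ X)
    (hu : IsQuasilinearLocalUtility X O u) : LawOfDemand O := by
  intro p x q y hx hy
  have h₁ := hu.quasilinear_left ⟨_, hx⟩ ⟨_, hy⟩ y (hO _ hy)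
  have h₂ := hu.quasilinear_right ⟨_, hx⟩ ⟨_, hy⟩ x (hO _ hx)
  simp only [sub_dotProduct, dotProduct_sub] at *
  linarith

/-- If `r x y = 0`, a nearby larger `y'` has `r y' x > 0`, and skew-symmetry reverses the sign. -/
theorem RationalizableConcave.rationalizableLNS (hX : HasNearbyLargerBundles X)
    (h : RationalizableConcave X O) : RationalizableLNS X O := by
  obtain ⟨r, -, hmono, -, hskew, hr⟩ := h
  refine ⟨r, fun x hx y hy hxy ε hε => ?_, hskew, hr⟩
  obtain ⟨y', hy', hlt, hdist⟩ := hX y hy ε hε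
  have h₁ : r y x < r y' x := hmono x hx hy hy' hlt
  have h₂ := hskew x hx y hy
  have h₃ := hskew x hx y' hy'
  exact ⟨y', hy', hdist, by linarith⟩

/-! ### Local utilities and the maximin rationalization -/

/-- The affine function of `x` with gradient the price of `o`, which values the bundle of `o` at
the average of the prices of `o` and `o'`. -/
noncomputable def supportingUtility (o o' : Obs L) (x : Vec L) : ℝ :=
  (o.1 + o'.1) ⬝ᵥ o.2 / 2 + o.1 ⬝ᵥ (x - o.2)

/-- The largest concave utility function supported by the prices of `o` and `o'`. -/
noncomputable def localUtility (o o' : Obs L) (x : Vec L) : ℝ :=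
  min (supportingUtility o o' x) (supportingUtility o' o x)

theorem localUtility_comm (o o' : Obs L) : localUtility o o' = localUtility o' o :=
  funext fun _ => min_comm _ _

theorem quasilinearUtilityRationalizes_localUtility {o o' : Obs L}
    (h : (o.1 - o'.1) ⬝ᵥ (o.2 - o'.2) ≤ 0) :
    QuasilinearUtilityRationalizes X o (localUtility o o') := by
  intro y _
  have h₁ : localUtility o o' y ≤ supportingUtility o o' y := min_le_left _ _
  have h₂ : localUtility o o' o.2 = supportingUtility o o' o.2 := by
    -- With this normalization the other affine function exceeds this one at `o.2` by `-(o.1 - o'.1)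
    -- ⬝ᵥ (o.2 - o'.2) / 2`.
    refine min_eq_left ?_
    simp only [supportingUtility, sub_dotProduct, dotProduct_sub, add_dotProduct] at *
    linarith
  rw [h₂]
  simp only [supportingUtility, dotProduct_sub, add_dotProduct] at *
  linarith

theorem concaveOn_supportingUtility (hX : Convex ℝ X) (o o' : Obs L) :
    ConcaveOn ℝ X (supportingUtility o o') := by
  refine ⟨hX, fun x _ y _ a b _ _ hab => le_of_eq ?_⟩
  simp only [supportingUtility, dotProduct_sub, dotProduct_add, dotProduct_smul, smul_eq_mul]
  linear_combination ((o.1 + o'.1) ⬝ᵥ o.2 / 2 - o.1 ⬝ᵥ o.2) * hab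

theorem strictMono_supportingUtility {o o' : Obs L} (ho : o.1 ∈ positivePrices L) :
    StrictMono (supportingUtility o o') := fun _ _ hxy =>
  add_lt_add_right (dotProduct_lt_dotProduct_of_positivePrices ho (sub_lt_sub_right hxy _)) _

theorem continuous_supportingUtility :
    Continuous fun z : (Obs L × Obs L) × Vec L => supportingUtility z.1.1 z.1.2 z.2 := by
  unfold supportingUtility dotProduct
  fun_prop

theorem continuous_localUtility :
    Continuous fun z : (Obs L × Obs L) × Vec L => localUtility z.1.1 z.1.2 z.2 :=
  continuous_supportingUtility.min <| continuous_supportingUtility.comp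
    (by fun_prop : Continuous fun z : (Obs L × Obs L) × Vec L => ((z.1.2, z.1.1), z.2))

theorem isQuasilinearLocalUtility_localUtility (hX : Convex ℝ X)
    (hpos : ∀ o ∈ O, o.1 ∈ positivePrices L) (hlaw : LawOfDemand O) :
    IsQuasilinearLocalUtility X O fun o o' => localUtility (o : Obs L) o' where
  symm _ _ := localUtility_comm _ _
  continuous_ref x _ := continuous_localUtility.comp
    (by fun_prop : Continuous fun z : O × O => (((z.1 : Obs L), (z.2 : Obs L)), x))
  continuousOn o o' := (continuous_localUtility.comp
    (by fun_prop : Continuous fun x : Vec L => (((o : Obs L), (o' : Obs L)), x))).continuousOn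
  strictMonoOn o o' := StrictMono.strictMonoOn (fun _ _ hxy => min_lt_min
    (strictMono_supportingUtility (hpos _ o.2) hxy)
    (strictMono_supportingUtility (hpos _ o'.2) hxy)) _
  concaveOn _ _ := (concaveOn_supportingUtility hX _ _).inf (concaveOn_supportingUtility hX _ _)
  quasilinear_left o o' :=
    quasilinearUtilityRationalizes_localUtility (hlaw _ _ _ _ o.2 o'.2)
  quasilinear_right o o' := by
    rw [localUtility_comm]
    exact quasilinearUtilityRationalizes_localUtility (hlaw _ _ _ _ o'.2 o.2)

/-- A nonempty compact data set with a quasilinear local utility has a maximin rationalization. -/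
theorem IsQuasilinearLocalUtility.rationalizableMaximin {u : O → O → Vec L → ℝ}
    (hcompact : IsCompact O) (hne : O.Nonempty) (hO : ∀ o ∈ O, o.2 ∈ X)
    (hu : IsQuasilinearLocalUtility X O u) : RationalizableMaximin X O := by
  have := isCompact_iff_compactSpace.1 hcompact
  have := hne.to_subtype
  have hcont : ∀ x ∈ X, ∀ y ∈ X, Continuous fun z : O × O => u z.1 z.2 x - u z.1 z.2 y :=
    fun x hx y hy => (hu.continuous_ref x hx).sub (hu.continuous_ref y hy)
  have hex : ∀ x y, ∃ m, x ∈ X → y ∈ X → IsGreatest {m : ℝ | ∃ μ : ProbabilityMeasure O,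
      IsLeast (range fun ν : ProbabilityMeasure O => maximinPayoff u x y ν μ) m} m := by
    intro x y
    by_cases hxy : x ∈ X ∧ y ∈ X
    · obtain ⟨m, hm⟩ := exists_isGreatest_isLeast_integral
        (f := fun o₁ o₂ => u o₁ o₂ x - u o₁ o₂ y) (hcont x hxy.1 y hxy.2)
      exact ⟨m, fun _ _ => hm⟩
    -- An arbitrary value outside `X`, where nothing is required.
    · exact ⟨0, fun hx hy => absurd ⟨hx, hy⟩ hxy⟩
  choose r hr using hex
  refine ⟨r, ⟨u, hu, fun x hx y hy => hr x y hx hy⟩, fun p x hpx y hy => ?_⟩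
  have hx : x ∈ X := hO _ hpx
  -- The maximizer plays the Dirac mass at `(p, x)`. Whatever the reply `o`, the utility `u o (p,
  -- x)` rationalizes `(p, x)`, so the payoff is at least `p (x - y)`.
  obtain ⟨o, -, ho⟩ := exists_isLeast_integral (continuous_integral_right_of_compactSpace
    (f := fun o₁ o₂ => u o₁ o₂ x - u o₁ o₂ y) (hcont x hx y hy) (diracProba ⟨(p, x), hpx⟩))
  have hle := (hr x y hx hy).2 ⟨_, ho⟩
  have hq := hu.quasilinear_right o ⟨(p, x), hpx⟩ y hy
  simp only [diracProba, ProbabilityMeasure.coe_mk, integral_dirac] at hle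
  simp only [dotProduct_sub] at *
  linarith

/-! ### A concave-convex function generated by the data -/

/-- The value of `z` at the cheapest prices in `O`. -/
noncomputable def cheapestValue (O : Set (Obs L)) (z : Vec L) : ℝ :=
  sInf ((fun o : Obs L => o.1 ⬝ᵥ z) '' O)

theorem isLeast_cheapestValue (hcompact : IsCompact O) (hne : O.Nonempty) (z : Vec L) :
    IsLeast ((fun o : Obs L => o.1 ⬝ᵥ z) '' O) (cheapestValue O z) :=
  (hcompact.image (continuous_fst.dotProduct continuous_const)).isLeast_sInf (hne.image _)

theorem cheapestValue_le (hcompact : IsCompact O) {o : Obs L} (ho : o ∈ O) (z : Vec L) :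
    cheapestValue O z ≤ o.1 ⬝ᵥ z :=
  (isLeast_cheapestValue hcompact ⟨o, ho⟩ z).2 ⟨o, ho, rfl⟩

theorem cheapestValue_zero (hcompact : IsCompact O) (hne : O.Nonempty) :
    cheapestValue O 0 = 0 := by
  obtain ⟨o, -, h⟩ := (isLeast_cheapestValue hcompact hne 0).1
  simpa using h.symm

theorem concaveOn_cheapestValue (hcompact : IsCompact O) (hne : O.Nonempty) :
    ConcaveOn ℝ univ (cheapestValue O) := by
  refine ⟨convex_univ, fun x _ y _ a b ha hb _ => ?_⟩
  obtain ⟨o, ho, h⟩ := (isLeast_cheapestValue hcompact hne (a • x + b • y)).1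
  simp only [dotProduct_add, dotProduct_smul, smul_eq_mul] at h ⊢
  rw [← h]
  exact add_le_add (mul_le_mul_of_nonneg_left (cheapestValue_le hcompact ho x) ha)
    (mul_le_mul_of_nonneg_left (cheapestValue_le hcompact ho y) hb)

/-- A finite concave function on a finite-dimensional space is continuous. -/
theorem continuous_cheapestValue (hcompact : IsCompact O) (hne : O.Nonempty) :
    Continuous (cheapestValue O) :=
  continuousOn_univ.1 ((concaveOn_cheapestValue hcompact hne).continuousOn isOpen_univ)

theorem strictMono_cheapestValue (hcompact : IsCompact O) (hne : O.Nonempty)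
    (hpos : ∀ o ∈ O, o.1 ∈ positivePrices L) : StrictMono (cheapestValue O) := by
  intro x y hxy
  obtain ⟨o, ho, h⟩ := (isLeast_cheapestValue hcompact hne y).1
  calc cheapestValue O x ≤ o.1 ⬝ᵥ x := cheapestValue_le hcompact ho x
    _ < o.1 ⬝ᵥ y := dotProduct_lt_dotProduct_of_positivePrices (hpos o ho) hxy
    _ = cheapestValue O y := h

/-- The closed convex hull of the observations `(p, a)` together with the expenditures `p a`. -/
def observationHull (O : Set (Obs L)) : Set (Obs L × ℝ) :=
  closedConvexHull ℝ ((fun o : Obs L => (o, o.1 ⬝ᵥ o.2)) '' O)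

theorem mem_observationHull {o : Obs L} (ho : o ∈ O) : (o, o.1 ⬝ᵥ o.2) ∈ observationHull O :=
  subset_closedConvexHull ⟨o, ho, rfl⟩

theorem isCompact_observationHull (hcompact : IsCompact O) : IsCompact (observationHull O) := by
  refine Metric.isCompact_of_isClosed_isBounded isClosed_closedConvexHull ?_
  rw [observationHull, closedConvexHull_eq_closure_convexHull]
  exact (isBounded_convexHull.2 (hcompact.image
    (continuous_id.prodMk (continuous_fst.dotProduct continuous_snd))).isBounded).closure

theorem cheapestValue_le_of_mem_observationHull (hcompact : IsCompact O) {k : Obs L × ℝ}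
    (hk : k ∈ observationHull O) (z : Vec L) : cheapestValue O z ≤ k.1.1 ⬝ᵥ z := by
  have hconv : Convex ℝ {k : Obs L × ℝ | cheapestValue O z ≤ k.1.1 ⬝ᵥ z} := by
    intro k hk l hl a b ha hb hab
    have h₁ := mul_le_mul_of_nonneg_left hk ha
    have h₂ := mul_le_mul_of_nonneg_left hl hb
    simp only [mem_ofPred_eq, Prod.fst_add, Prod.smul_fst, add_dotProduct, smul_dotProduct,
      smul_eq_mul] at h₁ h₂ ⊢
    linear_combination h₁ + h₂ - cheapestValue O z * hab
  refine closedConvexHull_min ?_ hconv (isClosed_le continuous_const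
    ((continuous_fst.comp continuous_fst).dotProduct continuous_const)) hk
  rintro _ ⟨o, ho, rfl⟩
  exact cheapestValue_le hcompact ho z

/-- At an observation `k = ((q, b), q b)` this is the law of demand. Carrying the expenditure as a
separate coordinate replaces the bilinear term `q b` and makes the inequality affine in `k`, so it
extends to the closed convex hull. -/
theorem LawOfDemand.le_of_mem_observationHull (hlaw : LawOfDemand O) {o : Obs L} (ho : o ∈ O)
    {k : Obs L × ℝ} (hk : k ∈ observationHull O) :
    k.2 - k.1.1 ⬝ᵥ o.2 ≤ o.1 ⬝ᵥ (k.1.2 - o.2) := by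
  have hconv : Convex ℝ
      {k : Obs L × ℝ | k.2 - k.1.1 ⬝ᵥ o.2 ≤ o.1 ⬝ᵥ (k.1.2 - o.2)} := by
    intro k hk l hl a b ha hb hab
    have h₁ := mul_le_mul_of_nonneg_left hk ha
    have h₂ := mul_le_mul_of_nonneg_left hl hb
    simp only [mem_ofPred_eq, Prod.fst_add, Prod.snd_add, Prod.smul_fst, Prod.smul_snd,
      add_dotProduct, smul_dotProduct, dotProduct_sub, dotProduct_add, dotProduct_smul,
      smul_eq_mul] at h₁ h₂ ⊢
    have h₃ : (a + b) * (o.1 ⬝ᵥ o.2) = o.1 ⬝ᵥ o.2 := by rw [hab, one_mul]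
    linarith
  refine closedConvexHull_min ?_ hconv (isClosed_le
    (continuous_snd.sub ((continuous_fst.comp continuous_fst).dotProduct continuous_const))
    (continuous_const.dotProduct ((continuous_snd.comp continuous_fst).sub continuous_const))) hk
  rintro _ ⟨o', ho', rfl⟩
  have h := hlaw _ _ _ _ ho' ho
  simp only [mem_ofPred_eq, sub_dotProduct, dotProduct_sub] at h ⊢
  linarith

/-- The gain from exchanging `y` for the mixture `k` of observations, and then moving to `x`. -/
noncomputable def exchangeGain (O : Set (Obs L)) (x y : Vec L) (k : Obs L × ℝ) : ℝ :=
  k.2 - k.1.1 ⬝ᵥ y + cheapestValue O (x - k.1.2)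

/-- The largest gain from exchanging `y` for `x` by way of a mixture of observations. -/
noncomputable def maxExchangeGain (O : Set (Obs L)) (x y : Vec L) : ℝ :=
  sSup (exchangeGain O x y '' observationHull O)

theorem isGreatest_maxExchangeGain (hcompact : IsCompact O) (hne : O.Nonempty) (x y : Vec L) :
    IsGreatest (exchangeGain O x y '' observationHull O) (maxExchangeGain O x y) := by
  obtain ⟨o, ho⟩ := hne
  refine ((isCompact_observationHull hcompact).image ?_).isGreatest_sSup
    (Set.Nonempty.image _ ⟨_, mem_observationHull ho⟩)
  have h₁ : Continuous fun k : Obs L × ℝ => k.1.1 ⬝ᵥ y :=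
    (continuous_fst.comp continuous_fst).dotProduct continuous_const
  exact (continuous_snd.sub h₁).add ((continuous_cheapestValue hcompact ⟨o, ho⟩).comp
    (continuous_const.sub (continuous_snd.comp continuous_fst)))

theorem exchangeGain_le (hcompact : IsCompact O) (hne : O.Nonempty) (x y : Vec L)
    {k : Obs L × ℝ} (hk : k ∈ observationHull O) :
    exchangeGain O x y k ≤ maxExchangeGain O x y :=
  (isGreatest_maxExchangeGain hcompact hne x y).2 ⟨k, hk, rfl⟩

/-- The exchange may go through `o` itself, with nothing left to value afterwards. -/
theorem le_maxExchangeGain (hcompact : IsCompact O) {o : Obs L} (ho : o ∈ O) (y : Vec L) :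
    o.1 ⬝ᵥ (o.2 - y) ≤ maxExchangeGain O o.2 y := by
  have h := exchangeGain_le hcompact ⟨o, ho⟩ o.2 y (mem_observationHull ho)
  simpa [exchangeGain, cheapestValue_zero hcompact ⟨o, ho⟩, dotProduct_sub] using h

/-- For a mixture with bundle `b`, the law of demand bounds the first part of the gain by `o.1 ⬝ᵥ (b
- o.2)`, and the cheapest value of `x - b` is at most `o.1 ⬝ᵥ (x - b)`; the sum telescopes. -/
theorem LawOfDemand.maxExchangeGain_le (hcompact : IsCompact O) (hlaw : LawOfDemand O)
    {o : Obs L} (ho : o ∈ O) (x : Vec L) : maxExchangeGain O x o.2 ≤ o.1 ⬝ᵥ (x - o.2) := by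
  obtain ⟨k, hk, h⟩ := (isGreatest_maxExchangeGain hcompact ⟨o, ho⟩ x o.2).1
  have h₁ := hlaw.le_of_mem_observationHull ho hk
  have h₂ := cheapestValue_le hcompact ho (x - k.1.2)
  rw [← h, exchangeGain]
  simp only [dotProduct_sub] at *
  linarith

/-- The gain is jointly concave in `x` and `k`, and partial maximization over a convex set preserves
concavity: the mixture of two maximizers is a candidate. -/
theorem concaveOn_maxExchangeGain (hcompact : IsCompact O) (hne : O.Nonempty) (y : Vec L) :
    ConcaveOn ℝ univ fun x => maxExchangeGain O x y := by
  refine ⟨convex_univ, fun x _ x' _ a b ha hb hab => ?_⟩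
  obtain ⟨k, hk, h⟩ := (isGreatest_maxExchangeGain hcompact hne x y).1
  obtain ⟨k', hk', h'⟩ := (isGreatest_maxExchangeGain hcompact hne x' y).1
  refine le_trans ?_ (exchangeGain_le hcompact hne (a • x + b • x') y
    (convex_closedConvexHull hk hk' ha hb hab))
  have hφ := (concaveOn_cheapestValue hcompact hne).2 (mem_univ (x - k.1.2))
    (mem_univ (x' - k'.1.2)) ha hb hab
  have heq : a • (x - k.1.2) + b • (x' - k'.1.2) =
      a • x + b • x' - (a • k.1.2 + b • k'.1.2) := by
    simp only [smul_sub]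
    abel
  rw [heq] at hφ
  simp only [← h, ← h', exchangeGain, smul_eq_mul, Prod.fst_add, Prod.snd_add, Prod.smul_fst,
    Prod.smul_snd, add_dotProduct, smul_dotProduct] at hφ ⊢
  linarith

/-- A maximum of functions affine in `y`. -/
theorem convexOn_maxExchangeGain (hcompact : IsCompact O) (hne : O.Nonempty) (x : Vec L) :
    ConvexOn ℝ univ (maxExchangeGain O x) := by
  refine ⟨convex_univ, fun y _ y' _ a b ha hb hab => ?_⟩
  obtain ⟨k, hk, h⟩ := (isGreatest_maxExchangeGain hcompact hne x (a • y + b • y')).1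
  have h₁ := mul_le_mul_of_nonneg_left (exchangeGain_le hcompact hne x y hk) ha
  have h₂ := mul_le_mul_of_nonneg_left (exchangeGain_le hcompact hne x y' hk) hb
  simp only [← h, exchangeGain, smul_eq_mul, dotProduct_add, dotProduct_smul] at h₁ h₂ ⊢
  linear_combination h₁ + h₂ - (k.2 + cheapestValue O (x - k.1.2)) * hab

theorem strictMono_maxExchangeGain (hcompact : IsCompact O) (hne : O.Nonempty)
    (hpos : ∀ o ∈ O, o.1 ∈ positivePrices L) (y : Vec L) :
    StrictMono fun x => maxExchangeGain O x y := by
  intro x x' hlt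
  obtain ⟨k, hk, h⟩ := (isGreatest_maxExchangeGain hcompact hne x y).1
  have hφ := strictMono_cheapestValue hcompact hne hpos (sub_lt_sub_right hlt k.1.2)
  have h' := exchangeGain_le hcompact hne x' y hk
  simp only [exchangeGain] at *
  linarith

theorem strictAnti_maxExchangeGain (hcompact : IsCompact O) (hne : O.Nonempty)
    (hpos : ∀ o ∈ O, o.1 ∈ positivePrices L) (x : Vec L) :
    StrictAnti (maxExchangeGain O x) := by
  intro y y' hlt
  obtain ⟨k, hk, h⟩ := (isGreatest_maxExchangeGain hcompact hne x y').1
  -- The price part of any mixture values `y' - y` at no less than its cheapest value, which is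
  -- positive.
  have h₀ := strictMono_cheapestValue hcompact hne hpos (sub_pos.2 hlt)
  have hp := cheapestValue_le_of_mem_observationHull hcompact hk (y' - y)
  have h' := exchangeGain_le hcompact hne x y hk
  rw [cheapestValue_zero hcompact hne] at h₀
  simp only [exchangeGain, dotProduct_sub] at *
  linarith

theorem LawOfDemand.rationalizableConcave (hcompact : IsCompact O) (hne : O.Nonempty)
    (hX : Convex ℝ X) (hpos : ∀ o ∈ O, o.1 ∈ positivePrices L) (hlaw : LawOfDemand O) :
    RationalizableConcave X O := by
  set s := maxExchangeGain O
  have hconc : ∀ y, ConcaveOn ℝ univ fun x => (s x y - s y x) / 2 := by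
    intro y
    have h := ((concaveOn_maxExchangeGain hcompact hne y).sub
      (convexOn_maxExchangeGain hcompact hne y)).smul (c := (2⁻¹ : ℝ)) (by norm_num)
    refine h.congr fun x _ => ?_
    simp [s, div_eq_inv_mul]
  refine ⟨fun x y => (s x y - s y x) / 2, fun y _ => ?_, fun y _ => ?_, fun y _ => ?_,
    fun x _ y _ => by ring, fun p x hpx y _ => ?_⟩
  · exact ((hconc y).continuousOn isOpen_univ).mono (subset_univ X)
  · intro x _ x' _ hlt
    have h₁ : s x y < s x' y := strictMono_maxExchangeGain hcompact hne hpos y hlt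
    have h₂ : s y x' < s y x := strictAnti_maxExchangeGain hcompact hne hpos y hlt
    change (s x y - s y x) / 2 < (s x' y - s y x') / 2
    linarith
  · exact (hconc y).subset (subset_univ X) hX
  · have h₁ : p ⬝ᵥ (x - y) ≤ s x y := le_maxExchangeGain hcompact hpx y
    have h₂ : s y x ≤ p ⬝ᵥ (y - x) := hlaw.maxExchangeGain_le hcompact hpx y
    simp only [dotProduct_sub] at *
    linarith

end Observations

theorem theorem6 {L : ℕ} (X P : Set (Vec L)) (D : Vec L → ℝ → Set (Vec L))
    (hX : X ⊆ nonzeroBundles L) (hXconv : Convex ℝ X)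
    (hP : P ⊆ positivePrices L)
    (hD : ∀ p ∈ P, ∀ w, D p w ⊆ X)
    (hcompact : IsCompact (demandData P D))
    (hne : (demandData P D).Nonempty) :
    (HasNearbyLargerBundles X →
      List.TFAE [
        RationalizableLNS X (demandData P D),
        LawOfDemand (demandData P D),
        RationalizableMaximin X (demandData P D),
        RationalizableConcave X (demandData P D)]) ∧
    (List.TFAE [
        LawOfDemand (demandData P D),
        RationalizableMaximin X (demandData P D),
        RationalizableConcave X (demandData P D)] ∧
      (RationalizableLNS X (demandData P D) → LawOfDemand (demandData P D))) := by
  have hO : ∀ o ∈ demandData P D, o.2 ∈ X := fun o ho => hD o.1 ho.1 _ ho.2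
  have hpos : ∀ o ∈ demandData P D, o.1 ∈ positivePrices L := fun o ho => hP ho.1
  have hlns : RationalizableLNS X (demandData P D) → LawOfDemand (demandData P D) :=
    fun ⟨_, _, hskew, hr⟩ => lawOfDemand_of_skewSymmetricOn hO hskew hr
  have hmaximin : LawOfDemand (demandData P D) ↔ RationalizableMaximin X (demandData P D) :=
    ⟨fun hlaw => (isQuasilinearLocalUtility_localUtility hXconv hpos hlaw).rationalizableMaximin
      hcompact hne hO, fun ⟨_, ⟨_, hu, _⟩, _⟩ => hu.lawOfDemand hO⟩
  have hconcave : LawOfDemand (demandData P D) ↔ RationalizableConcave X (demandData P D) :=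
    ⟨fun hlaw => hlaw.rationalizableConcave hcompact hne hXconv hpos,
      fun ⟨_, _, _, _, hskew, hr⟩ => lawOfDemand_of_skewSymmetricOn hO hskew hr⟩
  refine ⟨fun hnear => ?_, ?_, hlns⟩
  · tfae_have 1 → 2 := hlns
    tfae_have 2 ↔ 3 := hmaximin
    tfae_have 2 ↔ 4 := hconcave
    tfae_have 4 → 1 := fun h => h.rationalizableLNS hnear
    tfae_finish
  · tfae_have 1 ↔ 2 := hmaximin
    tfae_have 1 ↔ 3 := hconcave
    tfae_finish
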